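/- Let $\mathbb C_+=\{s\in\mathbb C:\operatorname{Re}s>0\}$. Let $D_a(\mathbb C_+)$ be the complex vector space of all Dirichlet series $D=\sum_{n=1}^\infty a_n n^{-s}$ with complex coefficients that converge absolutely at every point of $\mathbb C_+$, equivalently such that $\|D\|_\sigma:=\sum_{n=1}^\infty |a_n|n^{-\sigma}<\infty$ for every $\sigma>0$, endowed with the topology induced by the seminorms $\|\cdot\|_\sigma$, $\sigma>0$. For $N\in\mathbb N$ write $S_ND(s)=\sum_{n=1}^N a_n n^{-s}$ for the partial sums of $D$. Call $D\in D_a(\mathbb C_+)$ universal if for every entire function $g$ there is a strictly increasing sequence $(\lambda_n)$ of natural numbers such that, for every $\ell\in\{0,1,2,\dots\}$, the derivatives $(S_{\lambda_n}D)^{(\ell)}$ converge to $g^{(\ell)}$ as $n\to\infty$, uniformly on each compact subset of the closed left half-plane $\{s\in\mathbb C:\operatorname{Re}s\le 0\}$. Then universal Dirichlet series exist; the set of universal Dirichlet series is a dense $G_\delta$ subset of $D_a(\mathbb C_+)$; and there is a dense vector subspace $V$ of $D_a(\mathbb C_+)$ such that every $D\in V\setminus\{0\}$ is universal. -/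

import Mathlib

open Filter Topology

noncomputable section

namespace DirichletSeries

/-- The coefficient sequences `a = (a₁, a₂, …)` of Dirichlet series `∑_{n ≥ 1} a_n n^{-s}` such that
`∑_{n ≥ 1} |a_n| n^{-σ} < ∞` for all `σ > 0`. The unused entry `a 0` is normalised to `0`. -/
def absConvSubmodule : Submodule ℂ (ℕ → ℂ) where
  carrier := {a | a 0 = 0 ∧ ∀ σ : ℝ, 0 < σ → Summable fun n : ℕ => ‖a n‖ * (n : ℝ) ^ (-σ)}
  zero_mem' := by
    refine ⟨rfl, fun σ _ => ?_⟩
    simp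
  add_mem' := by
    rintro a b ⟨ha0, ha⟩ ⟨hb0, hb⟩
    refine ⟨by simp [ha0, hb0], fun σ hσ => ?_⟩
    refine Summable.of_nonneg_of_le (fun n => by positivity) (fun n => ?_) ((ha σ hσ).add (hb σ hσ))
    rw [← add_mul]
    exact mul_le_mul_of_nonneg_right (norm_add_le _ _) (by positivity)
  smul_mem' := by
    rintro c a ⟨ha0, ha⟩
    refine ⟨by simp [ha0], fun σ hσ => ?_⟩
    simpa [mul_assoc] using (ha σ hσ).mul_left ‖c‖

/-- Membership means exactly that the Dirichlet series converges absolutely at every point of the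
open right half-plane. -/
theorem mem_absConvSubmodule_iff (a : ℕ → ℂ) :
    a ∈ absConvSubmodule ↔ a 0 = 0 ∧ ∀ s : ℂ, 0 < s.re → LSeriesSummable a s := by
  have key : a 0 = 0 → ∀ s : ℂ,
      (LSeriesSummable a s ↔ Summable fun n : ℕ => ‖a n‖ * (n : ℝ) ^ (-s.re)) := by
    intro h0 s
    unfold LSeriesSummable
    rw [← summable_norm_iff]
    refine summable_congr fun n => ?_
    rw [LSeries.norm_term_eq]
    split_ifs with hn
    · simp [hn, h0]
    · rw [Real.rpow_neg (Nat.cast_nonneg n), div_eq_mul_inv]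
  constructor
  · rintro ⟨h0, h⟩
    exact ⟨h0, fun s hs => (key h0 s).2 (h s.re hs)⟩
  · rintro ⟨h0, h⟩
    exact ⟨h0, fun σ hσ => by simpa using (key h0 (σ : ℂ)).1 (h (σ : ℂ) (by simpa using hσ))⟩

/-- The space `D_a(ℂ₊)` of Dirichlet series absolutely convergent in the open right half-plane.
It is a type of its own, so that it does not inherit the topology of pointwise convergence of
coefficients from `ℕ → ℂ`. -/
def Da : Type := absConvSubmodule

instance : AddCommGroup Da := inferInstanceAs (AddCommGroup absConvSubmodule)

instance : Module ℂ Da := inferInstanceAs (Module ℂ absConvSubmodule)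

/-- The coefficients of a Dirichlet series. -/
def Da.coeff (D : Da) : ℕ → ℂ := D.1

theorem Da.coeff_add (D E : Da) : (D + E).coeff = D.coeff + E.coeff := rfl

theorem Da.coeff_smul (c : ℂ) (D : Da) : (c • D).coeff = c • D.coeff := rfl

theorem Da.summable (D : Da) {σ : ℝ} (hσ : 0 < σ) :
    Summable fun n : ℕ => ‖D.coeff n‖ * (n : ℝ) ^ (-σ) := D.2.2 σ hσ

/-- The norm `‖∑ a_n n^{-s}‖_σ = ∑ |a_n| n^{-σ}`, for `σ > 0`. -/
def Da.seminorm (σ : {σ : ℝ // 0 < σ}) : Seminorm ℂ Da :=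
  Seminorm.of (fun D => ∑' n : ℕ, ‖D.coeff n‖ * (n : ℝ) ^ (-(σ : ℝ)))
    (by
      intro D E
      rw [← (D.summable σ.2).tsum_add (E.summable σ.2)]
      refine ((D + E).summable σ.2).tsum_le_tsum (fun n => ?_)
        ((D.summable σ.2).add (E.summable σ.2))
      rw [← add_mul]
      exact mul_le_mul_of_nonneg_right (norm_add_le _ _) (by positivity))
    (by
      intro c D
      simp only [Da.coeff_smul, Pi.smul_apply, smul_eq_mul, norm_mul, mul_assoc]
      exact tsum_mul_left)

instance : Nonempty {σ : ℝ // 0 < σ} := ⟨⟨1, one_pos⟩⟩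

/-- The topology of `D_a(ℂ₊)` is the one induced by all the seminorms `‖·‖_σ`, `σ > 0`. -/
instance : TopologicalSpace Da :=
  (SeminormFamily.moduleFilterBasis (p := (Da.seminorm : SeminormFamily ℂ Da {σ : ℝ // 0 < σ}))).topology

theorem Da.withSeminorms : WithSeminorms (𝕜 := ℂ) (E := Da) Da.seminorm := ⟨rfl⟩

/-- The partial sum `S_N D (s) = ∑_{n=1}^N a_n n^{-s}`. -/
def Da.partialSum (D : Da) (N : ℕ) (s : ℂ) : ℂ :=
  ∑ n ∈ Finset.Icc 1 N, D.coeff n * (n : ℂ) ^ (-s)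

/-- For every entire function `g`, some subsequence of the partial sums of `D` converges to `g`,
together with all derivatives, uniformly on each compact subset of the closed left half-plane. -/
def Da.IsUniversal (D : Da) : Prop :=
  ∀ g : ℂ → ℂ, Differentiable ℂ g →
    ∃ lam : ℕ → ℕ, StrictMono lam ∧
      ∀ (l : ℕ) (K : Set ℂ), IsCompact K → K ⊆ {s : ℂ | s.re ≤ 0} →
        TendstoUniformlyOn (fun j : ℕ => iteratedDeriv l (D.partialSum (lam j)))
          (iteratedDeriv l g) atTop K

end DirichletSeries

end

/-!
Let `T N` send a Dirichlet series to the derivatives of its `N`-th partial sum on the closed left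
half-plane. A Dirichlet polynomial has eventually constant partial sums, so everything reduces to
*simultaneous approximation*: on a compact subset of `{re ≤ δ}` with `δ < σ`, every entire function
is a uniform limit of Dirichlet polynomials whose norms `‖·‖_σ` tend to `0`. The orbit of the
polynomial then stays near the target, and Baire's theorem shows that the universal series are
generic. The same argument applies to sequences of series: for a generic sequence `(D i)`, the
vectors `(T N (D i))_i` accumulate at every sequence of targets, and the `D i` are dense. If `g` is
a target and `∑ c i • D i ≠ 0`, say with `c k ≠ 0`, aim at `g / c k` in the coordinate `k` and at
`0` elsewhere; hence the span of `(D i)` is the required subspace.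

For the approximation, take the quotient of `ℓ¹ × C(K)` by the closed span of the pairs
`(n^{-σ} eₙ, n^{-s})`, and let `F z` be the class of `(0, exp (-z s))`. This is an entire function
of exponential type with values in a Banach space, and `F (log n) = O(n^{-σ})`. The points `log n`
are so dense that Lagrange interpolation extends this decay to the whole positive axis, while
`re s ≤ δ < σ` leaves no room for it: by Phragmén–Lindelöf, `F = 0`. Up to constants, the Taylor
coefficients of `F` are the classes of the monomials `(0, s^k)`, so all of these lie in the closed
span.
-/

noncomputable section

namespace DirichletSeries

section Universality

variable {E X : Type*} [TopologicalSpace X]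

/-- The points whose orbit under the family `T` accumulates at every point of `G`: the *universal
points* of `T` with respect to `G`. -/
def universalSet (T : ℕ → E → X) (G : Set X) : Set E :=
  {x | ∀ g ∈ G, MapClusterPt g atTop fun N ↦ T N x}

open TopologicalSpace in
theorem universalSet_eq_iInter_countableBasis [SecondCountableTopology X] (T : ℕ → E → X)
    (G : Set X) :
    universalSet T G =
      ⋂ B ∈ {B | B ∈ countableBasis X ∧ (B ∩ G).Nonempty}, ⋂ M, ⋃ N ≥ M, T N ⁻¹' B := by
  ext x
  simp only [universalSet, mapClusterPt_iff_frequently, frequently_atTop, Set.mem_ofPred_eq,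
    Set.mem_iInter, Set.mem_iUnion, Set.mem_preimage, exists_prop]
  constructor
  · rintro hx B ⟨hB, g, hgB, hgG⟩
    exact hx g hgG B (isOpen_of_mem_countableBasis hB |>.mem_nhds hgB)
  · intro hx g hg s hs M
    obtain ⟨B, hB, hgB, hBs⟩ := (isBasis_countableBasis X).mem_nhds_iff.1 hs
    obtain ⟨N, hN, hxN⟩ := hx B ⟨hB, g, hgB, hg⟩ M
    exact ⟨N, hN, hBs hxN⟩

variable [TopologicalSpace E]

theorem isGδ_universalSet [SecondCountableTopology X] {T : ℕ → E → X} (hT : ∀ N, Continuous (T N))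
    (G : Set X) : IsGδ (universalSet T G) := by
  rw [universalSet_eq_iInter_countableBasis]
  refine .biInter ((TopologicalSpace.countable_countableBasis X).mono fun _ hB ↦ hB.1)
    fun B hB ↦ .iInter fun M ↦ IsOpen.isGδ ?_
  exact isOpen_biUnion fun N _ ↦
    (TopologicalSpace.isOpen_of_mem_countableBasis hB.1).preimage (hT N)

/-- Every point of `E` is a limit of points whose orbit is eventually as close as prescribed to a
given target in `G`. In contrast with topological transitivity, the orbit has to *stay* in the
prescribed neighbourhood, which makes the notion stable under products. -/
def HasDenseBasins (T : ℕ → E → X) (G : Set X) : Prop :=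
  ∀ g ∈ G, ∀ B ∈ 𝓝 g, Dense {x | ∀ᶠ N in atTop, T N x ∈ B}

theorem HasDenseBasins.universalSet_mem_residual [SecondCountableTopology X] {T : ℕ → E → X}
    {G : Set X} (hTG : HasDenseBasins T G) (hT : ∀ N, Continuous (T N)) :
    universalSet T G ∈ residual E := by
  rw [universalSet_eq_iInter_countableBasis]
  refine (countable_bInter_mem ((TopologicalSpace.countable_countableBasis X).mono
    fun _ hB ↦ hB.1)).2 fun B ⟨hB, g, hgB, hgG⟩ ↦ countable_iInter_mem.2 fun M ↦ ?_
  have hBo : IsOpen B := TopologicalSpace.isOpen_of_mem_countableBasis hB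
  refine residual_of_dense_open (isOpen_biUnion fun N _ ↦ hBo.preimage (hT N)) ?_
  refine (hTG g hgG B (hBo.mem_nhds hgB)).mono fun x hx ↦ ?_
  obtain ⟨N, hxN, hN⟩ := (hx.and (eventually_ge_atTop M)).exists
  exact Set.mem_iUnion₂.2 ⟨N, hN, hxN⟩

theorem HasDenseBasins.pi {T : ℕ → E → X} {G : Set X} (hTG : HasDenseBasins T G) (ι : Type*) :
    HasDenseBasins (fun N (x : ι → E) i ↦ T N (x i)) (Set.univ.pi fun _ ↦ G) := by
  intro g hg B hB
  rw [nhds_pi, Filter.mem_pi] at hB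
  obtain ⟨I, hI, t, ht, htB⟩ := hB
  refine (dense_pi I fun i _ ↦ hTG (g i) (hg i trivial) (t i) (ht i)).mono fun x hx ↦ ?_
  filter_upwards [(eventually_all_finite hI).2 hx] with N hN
  exact htB hN

theorem eventually_residual_denseRange [SecondCountableTopology E] :
    ∀ᶠ f : ℕ → E in residual (ℕ → E), DenseRange f := by
  have hbasis := TopologicalSpace.isBasis_countableBasis E
  have hmeets : ∀ᶠ f : ℕ → E in residual (ℕ → E),
      ∀ U ∈ TopologicalSpace.countableBasis E, ∃ n, f n ∈ U := by
    refine (eventually_countable_ball (TopologicalSpace.countable_countableBasis E)).2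
      fun U hU ↦ residual_of_dense_open ?_ fun f ↦ ?_
    · simp only [Set.ofPred_exists]
      exact isOpen_iUnion fun n ↦ (hbasis.isOpen hU).preimage (continuous_apply n)
    · obtain ⟨u, hu⟩ := TopologicalSpace.nonempty_of_mem_countableBasis hU
      have hupdate : Tendsto (fun n ↦ Function.update f n u) atTop (𝓝 f) :=
        tendsto_pi_nhds.2 fun i ↦ tendsto_const_nhds.congr' <| by
          filter_upwards [eventually_gt_atTop i] with n hn
          rw [Function.update_of_ne hn.ne]
      exact mem_closure_of_tendsto hupdate (.of_forall fun n ↦ ⟨n, by simpa using hu⟩)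
  filter_upwards [hmeets] with f hf
  refine hbasis.dense_iff.2 fun U hU _ ↦ ?_
  obtain ⟨n, hn⟩ := hf U hU
  exact ⟨f n, hn, n, rfl⟩

variable {𝕜 : Type*} [Field 𝕜] [AddCommGroup E] [Module 𝕜 E] [AddCommGroup X] [Module 𝕜 X]
  [ContinuousAdd X] [ContinuousConstSMul 𝕜 X]

/-- If `c k ≠ 0`, then `∑ c i • f i` has `g` as an accumulation point as soon as the orbit of the
sequence `f` in the product space accumulates at `(0, …, 0, (c k)⁻¹ • g, 0, …)`. -/
theorem mem_universalSet_of_mem_span {T : ℕ → E →L[𝕜] X} {G : Submodule 𝕜 X} {f : ℕ → E}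
    (hf : f ∈ universalSet (fun N (x : ℕ → E) i ↦ T N (x i)) (Set.univ.pi fun _ ↦ (G : Set X)))
    {x : E} (hx : x ∈ Submodule.span 𝕜 (Set.range f)) (hx0 : x ≠ 0) :
    x ∈ universalSet (fun N ↦ T N) (G : Set X) := by
  intro g hg
  obtain ⟨c, rfl⟩ := Finsupp.mem_span_range_iff_exists_finsupp.1 hx
  obtain ⟨k, hk⟩ : ∃ k, c k ≠ 0 := by
    by_contra! hc
    obtain rfl : c = 0 := Finsupp.ext hc
    exact hx0 Finsupp.sum_zero_index
  have hcluster := hf (Pi.single k ((c k)⁻¹ • g)) fun i _ ↦ by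
    obtain rfl | hik := eq_or_ne i k
    · simpa using G.smul_mem _ hg
    · simp [hik]
  have hcont : Continuous fun y : ℕ → X ↦ c.sum fun i a ↦ a • y i :=
    continuous_finsetSum _ fun i _ ↦ (continuous_apply i).const_smul (c i)
  convert hcluster.continuousAt_comp hcont.continuousAt using 1
  · rw [Finsupp.sum, Finset.sum_eq_single k]
    · simp [hk]
    · intro i _ hik
      simp [hik]
    · simp [hk]
  · ext N
    simp [Finsupp.sum]

theorem HasDenseBasins.exists_dense_submodule [PolishSpace E] [SecondCountableTopology X]
    {T : ℕ → E →L[𝕜] X} {G : Submodule 𝕜 X} (hTG : HasDenseBasins (fun N ↦ T N) (G : Set X)) :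
    ∃ V : Submodule 𝕜 E, Dense (V : Set E) ∧
      ∀ x ∈ V, x ≠ 0 → x ∈ universalSet (fun N ↦ T N) (G : Set X) := by
  have hT (N : ℕ) : Continuous fun (x : ℕ → E) i ↦ T N (x i) := by fun_prop
  obtain ⟨f, hf, hdense⟩ := (dense_of_mem_residual
    (inter_mem ((hTG.pi ℕ).universalSet_mem_residual hT) eventually_residual_denseRange)).nonempty
  exact ⟨Submodule.span 𝕜 (Set.range f), hdense.mono Submodule.subset_span,
    fun x hx hx0 ↦ mem_universalSet_of_mem_span hf hx hx0⟩

end Universality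

section PhragmenLindelof

/-- The multiplier `exp (-a (w + 1) log (w + 1))`. On the right half-plane it decays
superexponentially along the real axis, at the price of a factor `exp (a π / 2 * |Im w|)`; the shift
by `1` makes it holomorphic up to the boundary. -/
def superexpDamping (a : ℝ) (w : ℂ) : ℂ := Complex.exp (-(a * ((w + 1) * Complex.log (w + 1))))

theorem norm_superexpDamping (a : ℝ) (w : ℂ) :
    ‖superexpDamping a w‖ =
      Real.exp (a * (w.im * (w + 1).arg - (w.re + 1) * Real.log ‖w + 1‖)) := by
  rw [superexpDamping, Complex.norm_exp]
  congr 1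
  rw [Complex.neg_re, Complex.re_ofReal_mul, Complex.mul_re, Complex.log_re, Complex.log_im,
    Complex.add_re, Complex.one_re, Complex.add_im, Complex.one_im, add_zero]
  ring

theorem norm_superexpDamping_le {a : ℝ} (ha : 0 ≤ a) {w : ℂ} (hw : 0 ≤ w.re) :
    ‖superexpDamping a w‖ ≤ Real.exp (a * (Real.pi / 2) * |w.im|) := by
  have hnorm : 1 ≤ ‖w + 1‖ := le_trans (by simpa using hw) (Complex.re_le_norm (w + 1))
  have harg : |(w + 1).arg| ≤ Real.pi / 2 :=
    Complex.abs_arg_le_pi_div_two_iff.2 (by simp only [Complex.add_re, Complex.one_re]; linarith)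
  have him : w.im * (w + 1).arg ≤ |w.im| * (Real.pi / 2) := by
    grw [le_abs_self (w.im * _), abs_mul, harg]
  have hlog : 0 ≤ (w.re + 1) * Real.log ‖w + 1‖ :=
    mul_nonneg (by linarith) (Real.log_nonneg hnorm)
  rw [norm_superexpDamping, Real.exp_le_exp, mul_assoc]
  gcongr
  linarith

theorem norm_superexpDamping_ofReal_le {a x : ℝ} (ha : 0 ≤ a) (hx : 1 ≤ x) :
    ‖superexpDamping a x‖ ≤ Real.exp (-(a * (x * Real.log x))) := by
  have hcast : ‖(x : ℂ) + 1‖ = x + 1 := by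
    rw [← Complex.ofReal_one, ← Complex.ofReal_add, Complex.norm_of_nonneg (by linarith)]
  have hlog : 0 ≤ Real.log x := Real.log_nonneg hx
  have hle : x * Real.log x ≤ (x + 1) * Real.log (x + 1) := by
    gcongr <;> linarith
  rw [norm_superexpDamping, hcast, Real.exp_le_exp]
  simp only [Complex.ofReal_im, Complex.ofReal_re, zero_mul, zero_sub, mul_neg, neg_le_neg_iff]
  gcongr

theorem diffContOnCl_superexpDamping (a : ℝ) :
    DiffContOnCl ℂ (superexpDamping a) {w | 0 < w.re} := by
  refine DifferentiableOn.diffContOnCl ?_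
  rw [Complex.closure_setOfPred_lt_re]
  intro w (hw : 0 ≤ w.re)
  have hslit : w + 1 ∈ Complex.slitPlane := .inl (by simpa using by linarith)
  have hlog : DifferentiableAt ℂ (fun w ↦ Complex.log (w + 1)) w :=
    (differentiableAt_id.add_const 1).clog hslit
  exact (((differentiableAt_id.add_const 1).mul hlog).const_mul _).neg.cexp.differentiableWithinAt

theorem superpolynomialDecay_exp_mul_superexpDamping {a : ℝ} (ha : 0 < a) (A : ℝ) :
    Asymptotics.SuperpolynomialDecay atTop Real.exp
      fun x : ℝ ↦ Real.exp (A * x) * ‖superexpDamping a x‖ := by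
  intro n
  have hlim : Tendsto (fun x : ℝ ↦ Real.exp (x * (n + A - a * Real.log x))) atTop (𝓝 0) := by
    refine Real.tendsto_exp_atBot.comp (tendsto_id.atTop_mul_atBot₀ ?_)
    exact tendsto_atBot_add_const_left _ _
      (tendsto_neg_atTop_atBot.comp (Real.tendsto_log_atTop.const_mul_atTop ha))
  refine squeeze_zero' (.of_forall fun x ↦ by positivity) ?_ hlim
  filter_upwards [eventually_ge_atTop 1] with x hx
  grw [norm_superexpDamping_ofReal_le ha.le hx]
  rw [← Real.exp_nat_mul, ← Real.exp_add, ← Real.exp_add]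
  exact (congrArg Real.exp (by ring)).le

variable {E : Type*} [NormedAddCommGroup E] [NormedSpace ℂ E]

theorem eqOn_zero_of_exponential_decay_on_imaginary_axis {f : ℂ → E}
    (hf : DiffContOnCl ℂ f {z | 0 < z.re}) {A C c : ℝ} (hc : 0 < c)
    (hgrowth : ∀ z, 0 < z.re → ‖f z‖ ≤ C * Real.exp (A * ‖z‖))
    (hdecay : ∀ y : ℝ, ‖f (y * Complex.I)‖ ≤ C * Real.exp (-c * |y|)) :
    Set.EqOn f 0 {z | 0 ≤ z.re} := by
  have hC : 0 ≤ C := nonneg_of_mul_nonneg_left ((norm_nonneg _).trans (hdecay 0)) (Real.exp_pos _)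
  obtain ⟨a, ha, hac⟩ : ∃ a : ℝ, 0 < a ∧ a * (Real.pi / 2) = c :=
    ⟨c / (Real.pi / 2), by positivity, div_mul_cancel₀ _ (by positivity)⟩
  have hdamp {z : ℂ} (hz : 0 ≤ z.re) : ‖superexpDamping a z‖ ≤ Real.exp (c * |z.im|) :=
    hac ▸ norm_superexpDamping_le ha.le hz
  have hzero : Set.EqOn (fun z ↦ superexpDamping a z • f z) 0 {z | 0 ≤ z.re} := by
    refine PhragmenLindelof.eq_zero_on_right_half_plane_of_superexponential_decay
      ((diffContOnCl_superexpDamping a).smul hf) ⟨1, by norm_num, c + A, ?_⟩ ?_ ⟨C, fun y ↦ ?_⟩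
    · refine .of_bound C (eventually_inf_principal.2 (.of_forall fun z (hz : 0 < z.re) ↦ ?_))
      grw [norm_smul, hdamp hz.le, hgrowth z hz, Complex.abs_im_le_norm]
      rw [Real.rpow_one, Real.norm_of_nonneg (by positivity), add_mul, Real.exp_add]
      exact (mul_left_comm _ _ _).le
    · refine ((superpolynomialDecay_exp_mul_superexpDamping ha A).const_mul
        C).trans_eventually_abs_le ?_
      filter_upwards [eventually_gt_atTop 0] with x hx
      have hfx := hgrowth x (by simpa using hx)
      rw [Complex.norm_of_nonneg hx.le] at hfx
      simp only [Function.comp_apply, norm_smul]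
      grw [hfx, ← le_abs_self (C * _), abs_of_nonneg (by positivity)]
      exact le_of_eq (by ring)
    · grw [norm_smul, hdamp (by simp), hdecay y]
      rw [mul_left_comm, ← Real.exp_add]
      simp
  intro z hz
  simpa [superexpDamping, Complex.exp_ne_zero] using hzero hz

theorem eq_zero_of_exponential_decay_on_real_axis {f : ℂ → E} (hf : Differentiable ℂ f)
    {A C c : ℝ} (hc : 0 < c) (hgrowth : ∀ z, ‖f z‖ ≤ C * Real.exp (A * ‖z‖))
    (hdecay : ∀ t : ℝ, ‖f t‖ ≤ C * Real.exp (-c * |t|)) : f = 0 := by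
  have hrotate {u : ℂ} (hu : ‖u‖ = 1)
      (huI : ∀ y : ℝ, ∃ t : ℝ, |t| = |y| ∧ u * (y * Complex.I) = t) :
      Set.EqOn (fun z ↦ f (u * z)) 0 {z | 0 ≤ z.re} := by
    refine eqOn_zero_of_exponential_decay_on_imaginary_axis (A := A) (C := C)
      (Differentiable.diffContOnCl (by fun_prop)) hc (fun z _ ↦ ?_) fun y ↦ ?_
    · simpa [hu] using hgrowth (u * z)
    · obtain ⟨t, hty, ht⟩ := huI y
      simpa only [ht, hty] using hdecay t
  ext z
  rcases le_total 0 z.im with hz | hz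
  · have hI := hrotate Complex.norm_I fun y ↦ ⟨-y, abs_neg y, by
      push_cast; linear_combination (y : ℂ) * Complex.I_mul_I⟩
    simpa [← mul_assoc] using hI (x := -Complex.I * z) (by simpa using hz)
  · have hI := hrotate (u := -Complex.I) (by simp) fun y ↦ ⟨y, rfl, by
      linear_combination -(y : ℂ) * Complex.I_mul_I⟩
    simpa [← mul_assoc] using hI (x := Complex.I * z) (by simpa using hz)

end PhragmenLindelof

section Interpolation

theorem exists_norm_sum_pow_smul_le (E : Type*) [SeminormedAddCommGroup E] [NormedSpace ℂ E]
    (k : ℕ) :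
    ∃ Λ : ℝ, 0 ≤ Λ ∧ ∀ (c : ℕ → E) (ε : ℝ),
      (∀ j < k, ‖∑ i ∈ Finset.range k, (j : ℂ) ^ i • c i‖ ≤ ε) →
      ∀ u ∈ Set.Icc (0 : ℝ) 1, ‖∑ i ∈ Finset.range k, (u : ℂ) ^ i • c i‖ ≤ Λ * ε := by
  let ℓ (j : ℕ) : Polynomial ℂ := Lagrange.basis (Finset.range k) (fun n : ℕ ↦ (n : ℂ)) j
  have hbound (j : ℕ) : ∃ b, ∀ u ∈ Set.Icc (0 : ℝ) 1, ‖(ℓ j).eval (u : ℂ)‖ ≤ b :=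
    isCompact_Icc.exists_bound_of_continuousOn (by fun_prop)
  choose b hb using hbound
  have hb0 (j : ℕ) : 0 ≤ b j := (norm_nonneg _).trans (hb j 0 (by simp))
  have hlagrange {i : ℕ} (hi : i < k) (u : ℂ) :
      ∑ j ∈ Finset.range k, (ℓ j).eval u * (j : ℂ) ^ i = u ^ i := by
    have hX := congrArg (Polynomial.eval u) (Lagrange.eq_interpolate (s := Finset.range k)
      (v := fun n : ℕ ↦ (n : ℂ)) (f := Polynomial.X ^ i) Nat.cast_injective.injOn
      (by simpa [Polynomial.degree_X_pow] using hi))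
    simpa [ℓ, Lagrange.interpolate_apply, Polynomial.eval_finsetSum, mul_comm] using hX.symm
  refine ⟨∑ j ∈ Finset.range k, b j, Finset.sum_nonneg fun j _ ↦ hb0 j, fun c ε hc u hu ↦ ?_⟩
  calc ‖∑ i ∈ Finset.range k, (u : ℂ) ^ i • c i‖
      = ‖∑ j ∈ Finset.range k, (ℓ j).eval (u : ℂ) • ∑ i ∈ Finset.range k, (j : ℂ) ^ i • c i‖ := by
        simp only [Finset.smul_sum, smul_smul]
        rw [Finset.sum_comm]
        refine congrArg _ (Finset.sum_congr rfl fun i hi ↦ ?_)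
        rw [← Finset.sum_smul, hlagrange (Finset.mem_range.1 hi)]
    _ ≤ ∑ j ∈ Finset.range k, b j * ε := by
        refine norm_sum_le_of_le _ fun j hj ↦ ?_
        rw [norm_smul]
        exact mul_le_mul (hb j u hu) (hc j (Finset.mem_range.1 hj)) (norm_nonneg _) (hb0 j)
    _ = (∑ j ∈ Finset.range k, b j) * ε := (Finset.sum_mul ..).symm

variable {E : Type*} [NormedAddCommGroup E] [NormedSpace ℂ E] [CompleteSpace E]

theorem norm_sub_taylor_le {f : ℂ → E} {c z : ℂ} {r M : ℝ} (hr : 0 < r)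
    (hf : DiffContOnCl ℂ f (Metric.ball c r)) (hM : ∀ w ∈ Metric.sphere c r, ‖f w‖ ≤ M)
    (hz : ‖z - c‖ ≤ r / 2) (k : ℕ) :
    ‖f z - ∑ n ∈ Finset.range k, (z - c) ^ n • (n.factorial : ℂ)⁻¹ • iteratedDeriv n f c‖
      ≤ 2 * M * (‖z - c‖ / r) ^ k := by
  set q : ℝ := ‖z - c‖ / r
  have hq : q ≤ 1 / 2 := by rw [div_le_iff₀ hr]; linarith
  have hq0 : 0 ≤ q := by positivity
  have hM0 : 0 ≤ M := (norm_nonneg _).trans (hM (c + r) (by simp [hr.le]))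
  have hterm (n : ℕ) :
      ‖(z - c) ^ n • (n.factorial : ℂ)⁻¹ • iteratedDeriv n f c‖ ≤ M * q ^ n := by
    grw [norm_smul, norm_smul, norm_pow, norm_inv, Complex.norm_natCast,
      Complex.norm_iteratedDeriv_le_of_forall_mem_sphere_norm_le n hr hf hM]
    rw [div_pow]
    field_simp
    rfl
  have htaylor : HasSum (fun n : ℕ ↦ (z - c) ^ n • (n.factorial : ℂ)⁻¹ • iteratedDeriv n f c)
      (f z) := by
    have hzr : z ∈ Metric.ball c r := by
      rw [mem_ball_iff_norm]
      linarith
    convert Complex.hasSum_taylorSeries_on_ball hf.differentiableOn hzr using 2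
    exact smul_comm ..
  have htail := (hasSum_nat_add_iff' k).2 htaylor
  have hgeom : HasSum (fun n ↦ M * q ^ (n + k)) (M * q ^ k * (1 - q)⁻¹) := by
    have hq1 : q < 1 := by linarith
    simpa only [pow_add, mul_assoc, mul_comm] using
      (hasSum_geometric_of_lt_one hq0 hq1).mul_left (M * q ^ k)
  calc _ ≤ M * q ^ k * (1 - q)⁻¹ := by
        rw [← htail.tsum_eq]
        exact tsum_of_norm_bounded hgeom fun n ↦ hterm (n + k)
    _ ≤ M * q ^ k * 2 := by
        gcongr
        rw [inv_le_comm₀ (by linarith) two_pos]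
        linarith
    _ = _ := by ring

theorem exists_norm_le_of_norm_add_natCast_le (E : Type*) [NormedAddCommGroup E] [NormedSpace ℂ E]
    [CompleteSpace E] {k : ℕ} (hk : 1 ≤ k) :
    ∃ Λ : ℝ, 0 ≤ Λ ∧ ∀ {f : ℂ → E} {a : ℂ} {r M ε : ℝ}, k ≤ r / 2 →
      DiffContOnCl ℂ f (Metric.ball a r) → (∀ w ∈ Metric.sphere a r, ‖f w‖ ≤ M) →
      (∀ j < k, ‖f (a + j)‖ ≤ ε) →
      ∀ u ∈ Set.Icc (0 : ℝ) 1, ‖f (a + u)‖ ≤ Λ * (ε + 2 * M * (k / r) ^ k) := by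
  obtain ⟨Λ, hΛ, hinterp⟩ := exists_norm_sum_pow_smul_le E k
  refine ⟨Λ + 1, by positivity, fun {f a r M ε} hkr hf hM hε u hu ↦ ?_⟩
  have hk' : (1 : ℝ) ≤ k := mod_cast hk
  have hr : 0 < r := by linarith
  have hε0 : 0 ≤ ε := (norm_nonneg _).trans (hε 0 hk)
  have hM0 : 0 ≤ M := (norm_nonneg _).trans (hM (a + r) (by simp [hr.le]))
  set P : ℂ → E := fun v ↦
    ∑ i ∈ Finset.range k, v ^ i • (i.factorial : ℂ)⁻¹ • iteratedDeriv i f a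
  set ρ : ℝ := 2 * M * (k / r) ^ k
  have hremainder {v : ℂ} (hv : ‖v‖ ≤ k) : ‖f (a + v) - P v‖ ≤ ρ := by
    have htaylor := norm_sub_taylor_le (z := a + v) hr hf hM (by simpa using hv.trans hkr) k
    simp only [add_sub_cancel_left] at htaylor
    grw [htaylor, hv]
  have hnodes (j : ℕ) (hj : j < k) : ‖P j‖ ≤ ε + ρ := by
    have hjk : ‖(j : ℂ)‖ ≤ k := by simpa using hj.le
    grw [norm_le_norm_add_norm_sub' (P j) (f (a + j)), hε j hj, norm_sub_rev, hremainder hjk]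
  have huk : ‖(u : ℂ)‖ ≤ k := by
    rw [Complex.norm_of_nonneg hu.1]
    exact hu.2.trans hk'
  calc ‖f (a + u)‖ ≤ ‖P u‖ + ‖f (a + u) - P u‖ := norm_le_norm_add_norm_sub' _ _
    _ ≤ Λ * (ε + ρ) + ρ := add_le_add (hinterp _ _ hnodes u hu) (hremainder huk)
    _ ≤ (Λ + 1) * (ε + ρ) := by linarith

open Asymptotics

theorem re_pos_and_norm_mem_Icc_of_mem_closedBall_natCast_half {a : ℕ} (ha : 0 < a) {w : ℂ}
    (hw : w ∈ Metric.closedBall (a : ℂ) (a / 2)) :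
    0 < w.re ∧ ‖w‖ ∈ Set.Icc (a / 2 : ℝ) (2 * a) := by
  rw [mem_closedBall_iff_norm] at hw
  have ha' : (0 : ℝ) < a := mod_cast ha
  have hre := (abs_le.1 ((Complex.abs_re_le_norm (w - a)).trans hw)).1
  rw [Complex.sub_re, Complex.natCast_re] at hre
  have hnorm := norm_le_norm_add_norm_sub' w a
  rw [Complex.norm_natCast] at hnorm
  exact ⟨by linarith, by linarith [Complex.re_le_norm w], by linarith⟩

theorem two_mul_rpow_mul_div_half_pow_le {a m σ : ℝ} {k : ℕ} (ha : 1 ≤ a) (hmσ : m + σ ≤ k) :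
    (2 * a) ^ m * (k / (a / 2)) ^ k ≤ 2 ^ m * (2 * k) ^ k * a ^ (-σ) := by
  have ha0 : 0 < a := by linarith
  have hpow : a ^ m * (a ^ k)⁻¹ ≤ a ^ (-σ) := by
    rw [← Real.rpow_natCast, ← Real.rpow_neg ha0.le, ← Real.rpow_add ha0]
    exact Real.rpow_le_rpow_of_exponent_le ha (by linarith)
  calc (2 * a) ^ m * (k / (a / 2)) ^ k = 2 ^ m * (2 * k) ^ k * (a ^ m * (a ^ k)⁻¹) := by
        rw [Real.mul_rpow two_pos.le ha0.le, div_div_eq_mul_div, div_pow, mul_comm (k : ℝ)]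
        ring
    _ ≤ 2 ^ m * (2 * k) ^ k * a ^ (-σ) := by grw [hpow]

variable {G : ℂ → E} {m σ : ℝ}

theorem exists_norm_add_le_rpow_of_isBigO_natCast (hG : DifferentiableOn ℂ G {z | 0 < z.re})
    (hm : 0 ≤ m) (hσ : 0 ≤ σ)
    (hgrowth : G =O[Bornology.cobounded ℂ ⊓ 𝓟 {z | 0 < z.re}] fun z ↦ ‖z‖ ^ m)
    (hnat : (fun n : ℕ ↦ G n) =O[atTop] fun n ↦ (n : ℝ) ^ (-σ)) :
    ∃ K, ∀ᶠ a : ℕ in atTop, ∀ u ∈ Set.Icc (0 : ℝ) 1, ‖G (a + u)‖ ≤ K * (a : ℝ) ^ (-σ) := by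
  obtain ⟨C, hC, hgrowth⟩ := hgrowth.exists_nonneg
  obtain ⟨R, -, hR⟩ := (hasBasis_cobounded_norm.inf_principal _).eventually_iff.1 hgrowth.bound
  obtain ⟨C', hC', hnat⟩ := hnat.exists_nonneg
  obtain ⟨N, hN⟩ := eventually_atTop.1 hnat.bound
  obtain ⟨k, hk, hmσ⟩ : ∃ k : ℕ, 1 ≤ k ∧ m + σ ≤ k :=
    ⟨⌈m + σ⌉₊ + 1, by simp, (Nat.le_ceil _).trans (by simp)⟩
  obtain ⟨Λ, hΛ, hbound⟩ := exists_norm_le_of_norm_add_natCast_le E hk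
  refine ⟨Λ * (C' + 2 * C * (2 ^ m * (2 * k) ^ k)), ?_⟩
  filter_upwards [eventually_ge_atTop N, eventually_ge_atTop (4 * k),
    eventually_ge_atTop ⌈2 * R⌉₊] with a haN hak haR u hu
  have ha : (4 * k : ℝ) ≤ a := mod_cast hak
  have hk1 : (1 : ℝ) ≤ k := mod_cast hk
  have ha0 : (0 : ℝ) < a := by linarith
  have hball {w : ℂ} := re_pos_and_norm_mem_Icc_of_mem_closedBall_natCast_half (w := w)
    (Nat.cast_pos.1 ha0)
  have hsphere (w : ℂ) (hw : w ∈ Metric.sphere (a : ℂ) (a / 2)) : ‖G w‖ ≤ C * (2 * a) ^ m := by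
    obtain ⟨hre, hRw, hle⟩ := hball (Metric.sphere_subset_closedBall hw)
    have hGw := hR ⟨(by linarith [Nat.ceil_le.1 haR] : R ≤ ‖w‖), hre⟩
    rw [Real.norm_of_nonneg (by positivity)] at hGw
    grw [hGw, hle]
  have hnodes (j : ℕ) (_ : j < k) : ‖G (a + j)‖ ≤ C' * (a : ℝ) ^ (-σ) := by
    have hj := hN (a + j) (by omega)
    rw [Real.norm_of_nonneg (by positivity)] at hj
    push_cast at hj
    grw [hj, Real.rpow_le_rpow_of_nonpos ha0 (by simp) (by linarith : -σ ≤ 0)]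
  have hdiff : DiffContOnCl ℂ G (Metric.ball a (a / 2)) :=
    (hG.mono fun w hw ↦ (hball (Metric.closure_ball_subset_closedBall hw)).1).diffContOnCl
  calc ‖G (a + u)‖
      ≤ Λ * (C' * (a : ℝ) ^ (-σ) + 2 * (C * (2 * a) ^ m) * (k / (a / 2)) ^ k) :=
        hbound (by linarith) hdiff hsphere hnodes u hu
    _ = Λ * (C' * (a : ℝ) ^ (-σ) + 2 * C * ((2 * a) ^ m * (k / (a / 2)) ^ k)) := by ring
    _ ≤ Λ * (C' * (a : ℝ) ^ (-σ) + 2 * C * (2 ^ m * (2 * k) ^ k * (a : ℝ) ^ (-σ))) := by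
        grw [two_mul_rpow_mul_div_half_pow_le (by linarith) hmσ]
    _ = _ := by ring

theorem isBigO_ofReal_of_isBigO_natCast (hG : DifferentiableOn ℂ G {z | 0 < z.re})
    (hm : 0 ≤ m) (hσ : 0 ≤ σ)
    (hgrowth : G =O[Bornology.cobounded ℂ ⊓ 𝓟 {z | 0 < z.re}] fun z ↦ ‖z‖ ^ m)
    (hnat : (fun n : ℕ ↦ G n) =O[atTop] fun n ↦ (n : ℝ) ^ (-σ)) :
    (fun x : ℝ ↦ G x) =O[atTop] fun x ↦ x ^ (-σ) := by
  obtain ⟨K, hK⟩ := exists_norm_add_le_rpow_of_isBigO_natCast hG hm hσ hgrowth hnat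
  have hfloor : (fun x : ℝ ↦ G x) =O[atTop] fun x ↦ (⌊x⌋₊ : ℝ) ^ (-σ) := by
    refine .of_bound K ?_
    filter_upwards [tendsto_nat_floor_atTop.eventually hK, eventually_ge_atTop 0] with x hx hx0
    have hfract := hx (x - ⌊x⌋₊) ⟨sub_nonneg.2 (Nat.floor_le hx0), by
      linarith [Nat.lt_floor_add_one x]⟩
    rw [Real.norm_of_nonneg (by positivity)]
    simpa using hfract
  exact hfloor.trans (isEquivalent_nat_floor.isTheta.rpow (.of_forall fun x ↦ by positivity)
    (eventually_ge_atTop 0)).isBigO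

end Interpolation

section Uniqueness

open Asymptotics

theorem exists_norm_le_mul_of_isBigO_cocompact {X E : Type*} [TopologicalSpace X]
    [SeminormedAddCommGroup E] {f : X → E} {g : X → ℝ} (hf : Continuous f) (hg : Continuous g)
    (hg0 : ∀ x, 0 < g x) (hfg : f =O[cocompact X] g) : ∃ C, ∀ x, ‖f x‖ ≤ C * g x := by
  obtain ⟨c, hc⟩ := hfg.bound
  obtain ⟨K, hK, hKc⟩ := mem_cocompact.1 hc
  obtain ⟨b, hb⟩ := hK.exists_bound_of_continuousOn
    (f := fun x ↦ ‖f x‖ / g x) (hf.norm.div hg fun x ↦ (hg0 x).ne').continuousOn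
  refine ⟨max b c, fun x ↦ ?_⟩
  by_cases hx : x ∈ K
  · have hbx := (le_abs_self _).trans (hb x hx)
    rw [div_le_iff₀ (hg0 x)] at hbx
    grw [hbx, ← le_max_left]
    exact (hg0 x).le
  · have hcx : ‖f x‖ ≤ c * ‖g x‖ := hKc hx
    rw [Real.norm_of_nonneg (hg0 x).le] at hcx
    grw [hcx, ← le_max_right]
    exact (hg0 x).le

theorem isBigO_comp_log_of_norm_le_exp {E : Type*} [SeminormedAddCommGroup E] {F : ℂ → E} {C R : ℝ}
    (hgrowth : ∀ z, ‖F z‖ ≤ C * Real.exp (R * ‖z‖)) :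
    (fun z ↦ F (Complex.log z)) =O[Bornology.cobounded ℂ] fun z ↦ ‖z‖ ^ |R| := by
  have hC : 0 ≤ C := by simpa using (norm_nonneg _).trans (hgrowth 0)
  refine .of_bound (C * Real.exp (|R| * Real.pi)) ?_
  filter_upwards [(hasBasis_cobounded_norm (E := ℂ)).mem_of_mem (i := 1) trivial]
    with z (hz : 1 ≤ ‖z‖)
  have hlog : ‖Complex.log z‖ ≤ Real.log ‖z‖ + Real.pi := by
    refine (Complex.norm_le_abs_re_add_abs_im _).trans ?_
    rw [Complex.log_re, Complex.log_im, abs_of_nonneg (Real.log_nonneg hz)]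
    grw [Complex.abs_arg_le_pi]
  grw [hgrowth, le_abs_self R, hlog]
  rw [Real.norm_of_nonneg (by positivity), Real.rpow_def_of_pos (by linarith), mul_assoc,
    ← Real.exp_add]
  exact (congrArg _ (congrArg _ (by ring))).le

variable {E : Type*} [NormedAddCommGroup E] [NormedSpace ℂ E] {F : ℂ → E}

theorem isBigO_cexp_smul {l : Filter ℝ} {κ : ℝ}
    (hF : (fun t : ℝ ↦ F t) =O[l] fun t ↦ Real.exp (-κ * t)) (τ : ℝ) :
    (fun t : ℝ ↦ Complex.exp (τ * t) • F t) =O[l] fun t ↦ Real.exp ((τ - κ) * t) := by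
  have hexp : (fun t : ℝ ↦ Complex.exp (τ * t)) =O[l] fun t ↦ Real.exp (τ * t) :=
    .of_norm_le fun t ↦ by rw [← Complex.ofReal_mul, Complex.norm_exp_ofReal]
  refine (hexp.smul hF).congr_right fun t ↦ ?_
  rw [smul_eq_mul, ← Real.exp_add]
  ring_nf

variable [CompleteSpace E]

theorem isBigO_exp_of_isBigO_log_natCast (hF : Differentiable ℂ F) {C R σ : ℝ}
    (hσ : 0 ≤ σ) (hgrowth : ∀ z, ‖F z‖ ≤ C * Real.exp (R * ‖z‖))
    (hnat : (fun n : ℕ ↦ F (Real.log n)) =O[atTop] fun n ↦ (n : ℝ) ^ (-σ)) :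
    (fun t : ℝ ↦ F t) =O[atTop] fun t ↦ Real.exp (-σ * t) := by
  have hdiff : DifferentiableOn ℂ (fun z ↦ F (Complex.log z)) {z | 0 < z.re} := fun z hz ↦
    (hF.differentiableAt.comp z (Complex.differentiableAt_log (.inl hz))).differentiableWithinAt
  have hreal := isBigO_ofReal_of_isBigO_natCast hdiff (abs_nonneg R) hσ
    ((isBigO_comp_log_of_norm_le_exp hgrowth).mono inf_le_left) (by simpa using hnat)
  refine (hreal.comp_tendsto Real.tendsto_exp_atTop).congr (fun t ↦ ?_) fun t ↦ ?_
  · simp only [Function.comp_apply]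
    rw [← Complex.ofReal_log (Real.exp_pos t).le, Real.log_exp]
  · rw [Function.comp_apply, ← Real.exp_mul, mul_comm]

theorem eq_zero_of_isBigO_log_natCast (hF : Differentiable ℂ F) {C R δ σ : ℝ}
    (hσ : 0 ≤ σ) (hδσ : δ < σ) (hgrowth : ∀ z, ‖F z‖ ≤ C * Real.exp (R * ‖z‖))
    (hleft : (fun t : ℝ ↦ F t) =O[atBot] fun t ↦ Real.exp (-δ * t))
    (hnat : (fun n : ℕ ↦ F (Real.log n)) =O[atTop] fun n ↦ (n : ℝ) ^ (-σ)) : F = 0 := by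
  -- The factor `exp (τ * z)` balances the two decay rates: the product decays like
  -- `exp (-((σ - δ) / 2) * |t|)` in both directions of the real axis.
  set τ : ℝ := (σ + δ) / 2 with hτ
  set h : ℂ → E := fun z ↦ Complex.exp (τ * z) • F z
  have hright := isBigO_exp_of_isBigO_log_natCast hF hσ hgrowth hnat
  have hdecay : (fun t : ℝ ↦ h t) =O[cocompact ℝ] fun t ↦ Real.exp (-((σ - δ) / 2) * |t|) := by
    rw [cocompact_eq_atBot_atTop]
    refine ((isBigO_cexp_smul hleft τ).congr' .rfl ?_).sup
      ((isBigO_cexp_smul hright τ).congr' .rfl ?_)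
    · filter_upwards [eventually_le_atBot 0] with t ht
      rw [abs_of_nonpos ht, hτ]
      ring_nf
    · filter_upwards [eventually_ge_atTop 0] with t ht
      rw [abs_of_nonneg ht, hτ]
      ring_nf
  have hdiff : Differentiable ℂ h := by fun_prop
  obtain ⟨C', hC'⟩ := exists_norm_le_mul_of_isBigO_cocompact
    (hdiff.continuous.comp Complex.continuous_ofReal) (by fun_prop) (fun t ↦ Real.exp_pos _) hdecay
  have hh (z : ℂ) : ‖h z‖ ≤ C * Real.exp ((|τ| + R) * ‖z‖) := by
    have hre : (τ * z).re ≤ |τ| * ‖z‖ := by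
      grw [Complex.re_le_norm, norm_mul, Complex.norm_real, Real.norm_eq_abs]
    grw [norm_smul, Complex.norm_exp, hre, hgrowth z, add_mul, Real.exp_add, mul_left_comm]
  have hzero : h = 0 := eq_zero_of_exponential_decay_on_real_axis (C := max C C') hdiff
    (by linarith : 0 < (σ - δ) / 2) (fun z ↦ (hh z).trans (by gcongr; exact le_max_left ..))
    fun t ↦ (hC' t).trans (by gcongr; exact le_max_right ..)
  ext z
  simpa [h, Complex.exp_ne_zero] using congrFun hzero z

end Uniqueness

section SimultaneousApproximation

variable {E : Type*} [NormedAddCommGroup E] [NormedSpace ℂ E]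

theorem map_pow_eq_zero_of_map_exp_smul_eq_zero {A : Type*} [NormedRing A] [NormedAlgebra ℂ A]
    [CompleteSpace A] (φ : A →L[ℂ] E) {x : A} (hφ : ∀ z : ℂ, φ (NormedSpace.exp (z • x)) = 0)
    (k : ℕ) : φ (x ^ k) = 0 := by
  have hderiv : ∀ z : ℂ, φ (NormedSpace.exp (z • x) * x ^ k) = 0 := by
    induction k with
    | zero => simpa using hφ
    | succ k ih =>
      intro z
      have hexp := (hasDerivAt_exp_smul_const x z).mul_const (x ^ k)
      have hzero := (φ.hasFDerivAt.comp_hasDerivAt z hexp).congr_of_eventuallyEq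
        (.of_forall fun w ↦ (ih w).symm)
      rw [pow_succ', ← mul_assoc]
      exact hzero.unique (hasDerivAt_const z 0)
  simpa using hderiv 0

section Compact

variable {K : Set ℂ} [CompactSpace K]

theorem exp_smul_restrict_id_apply (z : ℂ) (s : K) :
    NormedSpace.exp (z • (ContinuousMap.id ℂ).restrict K) s = Complex.exp (z * s) := by
  rw [Complex.exp_eq_exp_ℂ]
  exact NormedSpace.map_exp (ContinuousMap.evalAlgHom ℂ ℂ s) (continuous_eval_const s) _

theorem tendsto_taylor_restrict {g : C(ℂ, ℂ)} (hg : Differentiable ℂ g) :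
    Tendsto (fun k ↦ ∑ n ∈ Finset.range k,
      ((n.factorial : ℂ)⁻¹ * iteratedDeriv n g 0) • (ContinuousMap.id ℂ).restrict K ^ n)
      atTop (𝓝 (g.restrict K)) := by
  have hKc : IsCompact K := isCompact_iff_compactSpace.2 ‹_›
  obtain ⟨r, hr, hKr⟩ := hKc.isBounded.exists_pos_norm_le
  obtain ⟨M, hM⟩ := (isCompact_sphere (0 : ℂ) (2 * r)).exists_bound_of_continuousOn
    hg.continuous.continuousOn
  have hM0 : 0 ≤ M := (norm_nonneg _).trans (hM (2 * r : ℝ) (by simp [abs_of_pos hr]))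
  have hgeom : Tendsto (fun k : ℕ ↦ 2 * M * (1 / 2 : ℝ) ^ k) atTop (𝓝 0) := by
    simpa using (tendsto_pow_atTop_nhds_zero_of_lt_one (by norm_num : (0 : ℝ) ≤ 1 / 2)
      (by norm_num)).const_mul (2 * M)
  refine squeeze_zero_norm (fun k ↦ ?_) hgeom |> tendsto_sub_nhds_zero_iff.1
  rw [norm_sub_rev, ContinuousMap.norm_le _ (by positivity)]
  intro s
  have hs : ‖(s : ℂ) - 0‖ ≤ 2 * r / 2 := by simpa using hKr s s.2
  have hratio : ‖(s : ℂ) - 0‖ / (2 * r) ≤ 1 / 2 := by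
    rw [div_le_iff₀ (by positivity)]
    linarith
  have htaylor := norm_sub_taylor_le (by positivity) hg.diffContOnCl hM hs k
  grw [hratio] at htaylor
  refine le_trans (le_of_eq ?_) htaylor
  simp [ContinuousMap.sum_apply, mul_comm]

theorem map_restrict_eq_zero_of_map_exp_smul_eq_zero (φ : C(K, ℂ) →L[ℂ] E)
    (hφ : ∀ z : ℂ, φ (NormedSpace.exp (z • (ContinuousMap.id ℂ).restrict K)) = 0)
    {g : C(ℂ, ℂ)} (hg : Differentiable ℂ g) : φ (g.restrict K) = 0 := by
  have hlim := (φ.continuous.tendsto _).comp (tendsto_taylor_restrict (K := K) hg)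
  refine tendsto_nhds_unique hlim (tendsto_const_nhds.congr fun k ↦ ?_)
  simp only [Function.comp_apply, map_sum, map_smul,
    map_pow_eq_zero_of_map_exp_smul_eq_zero φ hφ, smul_zero, Finset.sum_const_zero]

variable [CompleteSpace E]

/-- If `φ` is small along the exponentials `s ↦ n^{-s}`, then `z ↦ φ (s ↦ exp (-z s))` is an entire
function of exponential type to which the uniqueness theorem applies. -/
theorem map_restrict_eq_zero_of_isBigO {δ σ : ℝ} (hσ : 0 ≤ σ) (hδσ : δ < σ)
    (hK : ∀ s ∈ K, s.re ≤ δ) (φ : C(K, ℂ) →L[ℂ] E)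
    (hφ : (fun n : ℕ ↦ φ (NormedSpace.exp (-(Real.log n : ℂ) • (ContinuousMap.id ℂ).restrict K)))
      =O[atTop] fun n ↦ (n : ℝ) ^ (-σ))
    {g : C(ℂ, ℂ)} (hg : Differentiable ℂ g) : φ (g.restrict K) = 0 := by
  set x : C(K, ℂ) := (ContinuousMap.id ℂ).restrict K
  have hKc : IsCompact K := isCompact_iff_compactSpace.2 ‹_›
  obtain ⟨R, -, hKR⟩ := hKc.isBounded.exists_pos_norm_le
  have hexp : Differentiable ℂ fun z : ℂ ↦ NormedSpace.exp (z • x) := fun z ↦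
    (hasDerivAt_exp_smul_const x z).differentiableAt
  have hdiff : Differentiable ℂ fun z : ℂ ↦ φ (NormedSpace.exp (-z • x)) :=
    φ.differentiable.comp (hexp.comp differentiable_neg)
  have hgrowth (z : ℂ) : ‖φ (NormedSpace.exp (-z • x))‖ ≤ ‖φ‖ * Real.exp (R * ‖z‖) := by
    refine φ.le_opNorm_of_le ((ContinuousMap.norm_le _ (Real.exp_pos _).le).2 fun s ↦ ?_)
    rw [exp_smul_restrict_id_apply, Complex.norm_exp, Real.exp_le_exp]
    grw [Complex.re_le_norm, norm_mul, norm_neg, hKR s s.2, mul_comm]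
  have hleft : (fun t : ℝ ↦ φ (NormedSpace.exp (-(t : ℂ) • x))) =O[atBot]
      fun t ↦ Real.exp (-δ * t) := by
    refine .of_bound ‖φ‖ ?_
    filter_upwards [eventually_le_atBot 0] with t ht
    rw [Real.norm_of_nonneg (Real.exp_pos _).le]
    refine φ.le_opNorm_of_le ((ContinuousMap.norm_le _ (Real.exp_pos _).le).2 fun s ↦ ?_)
    rw [exp_smul_restrict_id_apply, Complex.norm_exp, Real.exp_le_exp, ← Complex.ofReal_neg,
      Complex.re_ofReal_mul]
    nlinarith [hK s s.2]
  refine map_restrict_eq_zero_of_map_exp_smul_eq_zero φ (fun z ↦ ?_) hg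
  simpa using congrFun (eq_zero_of_isBigO_log_natCast hdiff hσ hδσ hgrowth hleft hφ) (-z)

end Compact

/-- The function `s ↦ (n + 1)^{-s}`. -/
def dirichletMonomial (n : ℕ) : C(ℂ, ℂ) where
  toFun s := ((n + 1 : ℕ) : ℂ) ^ (-s)
  continuous_toFun := continuous_neg.const_cpow (.inl (by exact_mod_cast n.succ_ne_zero))

theorem exp_smul_restrict_id_eq_dirichletMonomial {K : Set ℂ} [CompactSpace K] (n : ℕ) :
    NormedSpace.exp (-(Real.log (n + 1 : ℕ) : ℂ) • (ContinuousMap.id ℂ).restrict K) =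
      (dirichletMonomial n).restrict K := by
  ext s
  rw [exp_smul_restrict_id_apply, ContinuousMap.restrict_apply, dirichletMonomial,
    ContinuousMap.coe_mk, Complex.cpow_def_of_ne_zero (by exact_mod_cast n.succ_ne_zero),
    ← Complex.natCast_log, neg_mul_comm]

/-- The pair `(n + 1)^{-σ} e_n ∈ ℓ¹`, `s ↦ (n + 1)^{-s}` on `K`. Linear combinations of these pairs
record a Dirichlet polynomial through both its norm `‖·‖_σ` and its values on `K`. -/
def weightedMonomial (σ : ℝ) (K : Set ℂ) (n : ℕ) : lp (fun _ : ℕ ↦ ℂ) 1 × C(K, ℂ) :=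
  (lp.single 1 n (((n + 1 : ℕ) : ℝ) ^ (-σ) : ℝ), (dirichletMonomial n).restrict K)

/-- In the quotient by the closed span, the class of `(0, s ↦ (n + 1)^{-s})` is the class of
`(-(n + 1)^{-σ} e_n, 0)`, hence has norm at most `(n + 1)^{-σ}`. -/
theorem zero_prodMk_restrict_mem_topologicalClosure_span {K : Set ℂ} [CompactSpace K] {δ σ : ℝ}
    (hσ : 0 ≤ σ) (hδσ : δ < σ) (hK : ∀ s ∈ K, s.re ≤ δ) {g : C(ℂ, ℂ)} (hg : Differentiable ℂ g) :
    (0, g.restrict K) ∈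
      (Submodule.span ℂ (Set.range (weightedMonomial σ K))).topologicalClosure := by
  set M := (Submodule.span ℂ (Set.range (weightedMonomial σ K))).topologicalClosure
  have : IsClosed (M : Set (lp (fun _ : ℕ ↦ ℂ) 1 × C(K, ℂ))) :=
    Submodule.isClosed_topologicalClosure _
  let φ : C(K, ℂ) →L[ℂ] _ ⧸ M := M.mkQL.comp (.inr ℂ _ _)
  have hφ (x : C(K, ℂ)) : φ x = 0 ↔ (0, x) ∈ M := Submodule.Quotient.mk_eq_zero M
  refine (hφ _).1 (map_restrict_eq_zero_of_isBigO hσ hδσ hK φ (.of_norm_eventuallyLE ?_) hg)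
  filter_upwards [eventually_ge_atTop 1] with n hn
  obtain ⟨m, rfl⟩ := Nat.exists_eq_add_of_le' hn
  rw [exp_smul_restrict_id_eq_dirichletMonomial]
  have hmem : weightedMonomial σ K m ∈ M :=
    Submodule.le_topologicalClosure _ (Submodule.subset_span ⟨m, rfl⟩)
  have hmk : φ ((dirichletMonomial m).restrict K) =
      M.mkQL (-(weightedMonomial σ K m).1, 0) := by
    refine (Submodule.Quotient.eq M).2 ?_
    convert hmem using 1
    ext1 <;> simp [weightedMonomial]
  rw [hmk]
  refine (Submodule.Quotient.norm_mk_le M _).trans_eq ?_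
  rw [Prod.norm_mk, norm_zero, norm_neg, weightedMonomial, lp.norm_single one_pos,
    Complex.norm_real, Real.norm_of_nonneg (by positivity)]
  exact max_eq_left (by positivity)

end SimultaneousApproximation

section Topology

open TopologicalSpace

instance : IsTopologicalAddGroup Da := Da.withSeminorms.topologicalAddGroup

instance : ContinuousSMul ℂ Da := Da.withSeminorms.continuousSMul

namespace Da

theorem coeff_zero (D : Da) : D.coeff 0 = 0 := D.2.1

theorem ext {D E : Da} (h : ∀ n, D.coeff (n + 1) = E.coeff (n + 1)) : D = E := by
  refine Subtype.ext (funext fun n ↦ ?_)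
  cases n with
  | zero => exact D.coeff_zero.trans E.coeff_zero.symm
  | succ n => exact h n

theorem seminorm_apply (σ : {σ : ℝ // 0 < σ}) (D : Da) :
    Da.seminorm σ D = ∑' n : ℕ, ‖D.coeff (n + 1)‖ * ((n + 1 : ℕ) : ℝ) ^ (-(σ : ℝ)) := by
  refine ((D.summable σ.2).tsum_eq_zero_add).trans ?_
  simp [D.coeff_zero]

theorem seminorm_anti : Antitone Da.seminorm := fun σ τ hστ D ↦ by
  simp only [seminorm_apply]
  refine Summable.tsum_le_tsum (fun n ↦ ?_) ((summable_nat_add_iff 1).2 (D.summable τ.2))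
    ((summable_nat_add_iff 1).2 (D.summable σ.2))
  gcongr
  exact_mod_cast n.succ_pos

/-- The Dirichlet series `∑ a n * (n + 1)^{-s}`. -/
def ofCoeff (a : ℕ → ℂ)
    (ha : ∀ σ : ℝ, 0 < σ → Summable fun n ↦ ‖a n‖ * ((n + 1 : ℕ) : ℝ) ^ (-σ)) : Da :=
  ⟨fun n ↦ Nat.casesOn n 0 a, rfl, fun σ hσ ↦ by
    rw [← summable_nat_add_iff 1]
    exact ha σ hσ⟩

/-- The weighted coefficient sequence `(a_{n + 1} (n + 1)^{-σ})`, whose norm in `ℓ¹` is `‖·‖_σ`. -/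
def weighted (σ : {σ : ℝ // 0 < σ}) : Da →ₗ[ℂ] lp (fun _ : ℕ ↦ ℂ) 1 where
  toFun D := ⟨fun n ↦ D.coeff (n + 1) * (((n + 1 : ℕ) : ℝ) ^ (-(σ : ℝ)) : ℝ), memℓp_gen <| by
    refine ((summable_nat_add_iff 1).2 (D.summable σ.2)).congr fun n ↦ ?_
    rw [norm_mul, Complex.norm_real, Real.norm_of_nonneg (by positivity), ENNReal.toReal_one,
      Real.rpow_one]⟩
  map_add' D E := lp.ext <| funext fun n ↦ add_mul ..
  map_smul' c D := lp.ext <| funext fun n ↦ mul_assoc ..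

theorem weighted_apply (σ : {σ : ℝ // 0 < σ}) (D : Da) (n : ℕ) :
    weighted σ D n = D.coeff (n + 1) * (((n + 1 : ℕ) : ℝ) ^ (-(σ : ℝ)) : ℝ) := rfl

theorem weighted_apply_mul_rpow (σ : {σ : ℝ // 0 < σ}) (D : Da) (n : ℕ) :
    weighted σ D n * (((n + 1 : ℕ) : ℝ) ^ (σ : ℝ) : ℝ) = D.coeff (n + 1) := by
  rw [weighted_apply, mul_assoc, ← Complex.ofReal_mul, ← Real.rpow_add (by positivity),
    neg_add_cancel, Real.rpow_zero, Complex.ofReal_one, mul_one]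

theorem norm_weighted (σ : {σ : ℝ // 0 < σ}) (D : Da) : ‖weighted σ D‖ = Da.seminorm σ D := by
  rw [lp.norm_eq_tsum_rpow (by simp), seminorm_apply]
  simp only [ENNReal.toReal_one, Real.rpow_one, div_one]
  refine tsum_congr fun n ↦ ?_
  rw [weighted_apply, norm_mul, Complex.norm_real, Real.norm_of_nonneg (by positivity)]

theorem continuous_weighted (σ : {σ : ℝ // 0 < σ}) : Continuous (weighted σ) :=
  Da.withSeminorms.continuous_normedSpace_rng _ _ ⟨{σ}, 1, fun D ↦ by simp [norm_weighted]⟩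

theorem continuous_coeff_succ (n : ℕ) : Continuous fun D : Da ↦ D.coeff (n + 1) := by
  simp only [← weighted_apply_mul_rpow ⟨1, one_pos⟩]
  exact ((lp.evalCLM ℂ _ 1 n).continuous.comp (continuous_weighted _)).mul_const _

theorem summable_norm_piSingle_mul_rpow (n : ℕ) (σ : ℝ) :
    Summable fun m ↦ ‖(Pi.single n 1 : ℕ → ℂ) m‖ * ((m + 1 : ℕ) : ℝ) ^ (-σ) :=
  summable_of_ne_finset_zero (s := {n}) fun m hm ↦ by
    rw [Pi.single_eq_of_ne (by simpa using hm), norm_zero, zero_mul]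

/-- The Dirichlet series `(n + 1)^{-s}`. -/
def monomial (n : ℕ) : Da :=
  ofCoeff (Pi.single n 1) fun σ _ ↦ summable_norm_piSingle_mul_rpow n σ

theorem coeff_monomial (n m : ℕ) : (monomial n).coeff (m + 1) = (Pi.single n 1 : ℕ → ℂ) m := rfl

theorem weighted_monomial (σ : {σ : ℝ // 0 < σ}) (n : ℕ) :
    weighted σ (monomial n) = lp.single 1 n (((n + 1 : ℕ) : ℝ) ^ (-(σ : ℝ)) : ℝ) := by
  ext m
  rw [weighted_apply, coeff_monomial, lp.single_apply]
  rcases eq_or_ne m n with rfl | hmn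
  · rw [Pi.single_eq_same, Pi.single_eq_same, one_mul]
  · rw [Pi.single_eq_of_ne hmn, Pi.single_eq_of_ne hmn, zero_mul]

/-- The exponents `1 / (k + 1)`; their seminorms suffice to define the topology of `Da`. -/
def exponent (k : ℕ) : {σ : ℝ // 0 < σ} := ⟨1 / (k + 1), Nat.one_div_pos_of_nat⟩

theorem exists_exponent_le (σ : {σ : ℝ // 0 < σ}) : ∃ k, exponent k ≤ σ :=
  (exists_nat_one_div_lt σ.2).imp fun _ h ↦ h.le

/-- The embedding of `Da` into a countable power of `ℓ¹` by the coefficient sequences weighted with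
the exponents `1 / (k + 1)`. -/
def embedding : Da →ₗ[ℂ] ℕ → lp (fun _ : ℕ ↦ ℂ) 1 := LinearMap.pi fun k ↦ weighted (exponent k)

theorem embedding_apply (D : Da) (k : ℕ) : embedding D k = weighted (exponent k) D := rfl

theorem continuous_embedding : Continuous embedding :=
  continuous_pi fun k ↦ continuous_weighted (exponent k)

theorem exists_ball_exponent_subset {D : Da} {U : Set Da} (hU : U ∈ 𝓝 D) :
    ∃ k, ∃ r > 0, (Da.seminorm (exponent k)).ball D r ⊆ U := by
  obtain ⟨s, r, hr, hball⟩ := (Da.withSeminorms.mem_nhds_iff D U).1 hU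
  obtain ⟨σ, hσ⟩ := (directed_id (r := (· ≥ ·))).finset_le s
  obtain ⟨k, hk⟩ := exists_exponent_le σ
  exact ⟨k, r, hr, (Seminorm.ball_antitone
    (Finset.sup_le fun τ hτ ↦ seminorm_anti (hk.trans (hσ τ hτ)))).trans hball⟩

theorem isInducing_embedding : IsInducing embedding := by
  refine IsTopologicalAddGroup.isInducing_iff_nhds_zero.2 (le_antisymm ?_ fun U hU ↦ ?_)
  · rw [← map_zero embedding]
    exact (continuous_embedding.tendsto 0).le_comap
  · obtain ⟨k, r, hr, hball⟩ := exists_ball_exponent_subset hU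
    refine mem_comap.2 ⟨(fun y ↦ y k) ⁻¹' Metric.ball 0 r,
      (continuous_apply k).continuousAt.preimage_mem_nhds (Metric.ball_mem_nhds 0 hr),
      fun D hD ↦ hball ?_⟩
    rw [Seminorm.mem_ball_zero, ← norm_weighted]
    exact mem_ball_zero_iff.1 hD

theorem injective_embedding : Function.Injective embedding := fun D E hDE ↦ ext fun n ↦ by
  rw [← weighted_apply_mul_rpow (exponent 0), ← weighted_apply_mul_rpow (exponent 0) E,
    ← embedding_apply, ← embedding_apply, hDE]

theorem range_embedding : Set.range embedding =
    {y | ∀ k n, (y k n * (((n + 1 : ℕ) : ℝ) ^ (exponent k : ℝ) : ℝ) : ℂ) =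
      y 0 n * (((n + 1 : ℕ) : ℝ) ^ (exponent 0 : ℝ) : ℝ)} := by
  refine Set.Subset.antisymm ?_ fun y hy ↦ ?_
  · rintro _ ⟨D, rfl⟩ k n
    rw [embedding_apply, embedding_apply, weighted_apply_mul_rpow, weighted_apply_mul_rpow]
  · obtain ⟨a, a_mul_rpow⟩ : ∃ a : ℕ → ℂ, ∀ k n,
        a n * (((n + 1 : ℕ) : ℝ) ^ (-(exponent k : ℝ)) : ℝ) = y k n :=
      ⟨fun n ↦ y 0 n * (((n + 1 : ℕ) : ℝ) ^ (exponent 0 : ℝ) : ℝ), fun k n ↦ by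
        beta_reduce
        rw [← hy k n, mul_assoc, ← Complex.ofReal_mul, ← Real.rpow_add (by positivity),
          add_neg_cancel, Real.rpow_zero, Complex.ofReal_one, mul_one]⟩
    refine ⟨ofCoeff a fun σ hσ ↦ ?_, funext fun k ↦ lp.ext (funext fun n ↦ a_mul_rpow k n)⟩
    obtain ⟨k, hk⟩ := exists_exponent_le ⟨σ, hσ⟩
    have summable_norm : Summable fun n ↦ ‖y k n‖ := by
      simpa using (lp.memℓp (y k)).summable (by simp)
    refine summable_norm.of_nonneg_of_le (fun n ↦ by positivity) fun n ↦ ?_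
    calc ‖a n‖ * ((n + 1 : ℕ) : ℝ) ^ (-σ)
        ≤ ‖a n‖ * ((n + 1 : ℕ) : ℝ) ^ (-(exponent k : ℝ)) := by
          gcongr
          exacts [by exact_mod_cast n.succ_pos, hk]
      _ = ‖y k n‖ := by
          rw [← a_mul_rpow k, norm_mul, Complex.norm_real, Real.norm_of_nonneg (by positivity)]

theorem isClosedEmbedding_embedding : IsClosedEmbedding embedding where
  toIsInducing := isInducing_embedding
  injective := injective_embedding
  isClosed_range := by
    rw [range_embedding]
    simp only [Set.ofPred_forall]
    have continuous_coord (k n : ℕ) :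
        Continuous fun y : ℕ → lp (fun _ : ℕ ↦ ℂ) 1 ↦ y k n :=
      (lp.evalCLM ℂ _ 1 n).continuous.comp (continuous_apply k)
    exact isClosed_iInter fun k ↦ isClosed_iInter fun n ↦
      isClosed_eq ((continuous_coord k n).mul_const _) ((continuous_coord 0 n).mul_const _)

theorem hasSum_monomial (D : Da) : HasSum (fun n ↦ D.coeff (n + 1) • monomial n) D := by
  refine (isInducing_embedding.hasSum_iff (g := embedding) _ D).1 (Pi.hasSum.2 fun k ↦ ?_)
  convert lp.hasSum_single (by simp) (embedding D k) using 2 with n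
  rw [Function.comp_apply, map_smul, Pi.smul_apply, embedding_apply, embedding_apply,
    weighted_monomial, weighted_apply, ← lp.single_smul, smul_eq_mul]

theorem dense_span_monomial : Dense (Submodule.span ℂ (Set.range monomial) : Set Da) := fun D ↦
  mem_closure_of_tendsto (hasSum_monomial D) <| .of_forall fun _ ↦
    Submodule.sum_mem _ fun n _ ↦ Submodule.smul_mem _ _ (Submodule.subset_span ⟨n, rfl⟩)

instance : IsCompletelyMetrizableSpace Da :=
  isClosedEmbedding_embedding.IsCompletelyMetrizableSpace

instance : SeparableSpace Da :=
  isSeparable_univ_iff.1 <| (Set.countable_range monomial).isSeparable.span (R := ℂ) |>.closure.mono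
    fun D _ ↦ dense_span_monomial D

instance : SecondCountableTopology Da :=
  letI := metrizableSpaceMetric Da
  UniformSpace.secondCountable_of_separable Da

instance : PolishSpace Da where

/-- The coefficient of `(n + 1)^{-s}`, as a continuous linear functional. -/
def coeffCLM (n : ℕ) : Da →L[ℂ] ℂ where
  toFun D := D.coeff (n + 1)
  map_add' _ _ := rfl
  map_smul' _ _ := rfl
  cont := continuous_coeff_succ n

theorem coeffCLM_apply (n : ℕ) (D : Da) : coeffCLM n D = D.coeff (n + 1) := rfl

end Da

end Topology

section Jets

/-- The space of entire functions. -/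
def entire : Submodule ℂ (ℂ → ℂ) where
  carrier := {f | Differentiable ℂ f}
  zero_mem' := differentiable_const 0
  add_mem' hf hg := Differentiable.add hf hg
  smul_mem' c _ hf := Differentiable.const_smul hf c

theorem entire.contDiff (f : entire) (n : WithTop ℕ∞) : ContDiff ℂ n (f : ℂ → ℂ) :=
  Differentiable.contDiff f.2

/-- The closed left half-plane. -/
def leftHalfPlane : Set ℂ := {s | s.re ≤ 0}

theorem isClosed_leftHalfPlane : IsClosed leftHalfPlane :=
  isClosed_le Complex.continuous_re continuous_const

instance : LocallyCompactSpace leftHalfPlane := isClosed_leftHalfPlane.locallyCompactSpace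

/-- The derivatives of all orders of an entire function, restricted to the closed left half-plane.
The target carries the topology of locally uniform convergence in each order. -/
def jet : entire →ₗ[ℂ] ℕ → C(leftHalfPlane, ℂ) where
  toFun f l := ContinuousMap.restrict leftHalfPlane
    ⟨iteratedDeriv l (f : ℂ → ℂ), (entire.contDiff f l).continuous_iteratedDeriv l le_rfl⟩
  map_add' f g := by
    ext l s
    exact iteratedDeriv_add (entire.contDiff f l).contDiffAt (entire.contDiff g l).contDiffAt
  map_smul' c f := by
    ext l s
    exact iteratedDeriv_const_smul (entire.contDiff f l).contDiffAt c

theorem tendsto_jet_iff {ι : Type*} {p : Filter ι} {f : ι → entire} {g : entire} :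
    Tendsto (fun j ↦ jet (f j)) p (𝓝 (jet g)) ↔
      ∀ (l : ℕ) (K : Set ℂ), IsCompact K → K ⊆ {s : ℂ | s.re ≤ 0} →
        TendstoUniformlyOn (fun j ↦ iteratedDeriv l (f j : ℂ → ℂ))
          (iteratedDeriv l (g : ℂ → ℂ)) p K := by
  simp only [tendsto_pi_nhds, ContinuousMap.tendsto_iff_forall_isCompact_tendstoUniformlyOn]
  refine forall_congr' fun l ↦ ⟨fun h K hK hK0 ↦ ?_, fun h K hK ↦ ?_⟩
  · have hK' := isClosed_leftHalfPlane.isClosedEmbedding_subtypeVal.isCompact_preimage hK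
    exact fun u hu ↦ (h _ hK' u hu).mono fun j hj s hs ↦ hj ⟨s, hK0 hs⟩ hs
  · have hK0 : Subtype.val '' K ⊆ leftHalfPlane := Subtype.coe_image_subset _ _
    exact ((h _ (hK.image continuous_subtype_val) hK0).comp Subtype.val).mono
      (Set.subset_preimage_image _ _)

theorem tendstoLocallyUniformlyOn_iteratedDeriv {ι : Type*} {p : Filter ι} {F : ι → ℂ → ℂ}
    {f : ℂ → ℂ} {U : Set ℂ} (hU : IsOpen U) (h : TendstoLocallyUniformlyOn F f p U)
    (hF : ∀ j, Differentiable ℂ (F j)) (l : ℕ) :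
    TendstoLocallyUniformlyOn (fun j ↦ iteratedDeriv l (F j)) (iteratedDeriv l f) p U := by
  induction l with
  | zero => simpa only [iteratedDeriv_zero] using h
  | succ l ih =>
    simp only [iteratedDeriv_succ]
    refine ih.deriv (.of_forall fun j ↦ Differentiable.differentiableOn ?_) hU
    exact (hF j).contDiff.differentiable_iteratedDeriv (n := l + 1) l
      (by exact_mod_cast l.lt_succ_self)

theorem tendsto_jet_of_tendstoLocallyUniformlyOn {ι : Type*} {p : Filter ι} {δ : ℝ} (hδ : 0 < δ)
    {f : ι → entire} {g : entire}
    (h : TendstoLocallyUniformlyOn (fun j ↦ (f j : ℂ → ℂ)) (g : ℂ → ℂ) p {s : ℂ | s.re < δ}) :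
    Tendsto (fun j ↦ jet (f j)) p (𝓝 (jet g)) := by
  have hU : IsOpen {s : ℂ | s.re < δ} := isOpen_lt Complex.continuous_re continuous_const
  exact tendsto_jet_iff.2 fun l K hK hK0 ↦ (tendstoLocallyUniformlyOn_iff_forall_isCompact hU).1
    (tendstoLocallyUniformlyOn_iteratedDeriv hU h (fun j ↦ (f j).2) l) K
    (hK0.trans fun s hs ↦ lt_of_le_of_lt hs hδ) hK

end Jets

section Conclusion

open Finsupp (linearCombination range_linearCombination linearCombination_apply)

/-- The entire function `s ↦ (n + 1)^{-s}`. -/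
def entireMonomial (n : ℕ) : entire :=
  ⟨dirichletMonomial n, differentiable_id.neg.const_cpow (.inl (by exact_mod_cast n.succ_ne_zero))⟩

/-- The `N`-th partial sum, as a linear map into the entire functions. -/
def partialSumLinearMap (N : ℕ) : Da →ₗ[ℂ] entire :=
  ∑ n ∈ Finset.range N, (Da.coeffCLM n : Da →ₗ[ℂ] ℂ).smulRight (entireMonomial n)

theorem partialSumLinearMap_apply (N : ℕ) (D : Da) :
    partialSumLinearMap N D = ∑ n ∈ Finset.range N, D.coeff (n + 1) • entireMonomial n := by
  simp [partialSumLinearMap, Da.coeffCLM_apply]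

theorem coe_partialSumLinearMap (N : ℕ) (D : Da) :
    (partialSumLinearMap N D : ℂ → ℂ) = D.partialSum N := by
  ext s
  rw [partialSumLinearMap_apply, Da.partialSum, Finset.range_eq_Ico,
    ← Finset.Ico_add_one_right_eq_Icc, ← Finset.sum_Ico_add' _ 0 N 1]
  simp [entireMonomial, dirichletMonomial]

theorem partialSumLinearMap_monomial {n N : ℕ} (hn : n < N) :
    partialSumLinearMap N (Da.monomial n) = entireMonomial n := by
  rw [partialSumLinearMap_apply,
    Finset.sum_eq_single_of_mem n (Finset.mem_range.2 hn) fun m _ hm ↦ ?_,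
    Da.coeff_monomial, Pi.single_eq_same, one_smul]
  rw [Da.coeff_monomial, Pi.single_eq_of_ne hm, zero_smul]

theorem eventually_partialSumLinearMap_linearCombination (c : ℕ →₀ ℂ) :
    ∀ᶠ N in atTop, partialSumLinearMap N (linearCombination ℂ Da.monomial c) =
      linearCombination ℂ entireMonomial c := by
  filter_upwards [(eventually_all_finset c.support).2 fun n _ ↦ eventually_gt_atTop n] with N hN
  rw [LinearMap.map_finsupp_linearCombination]
  exact Finsupp.sum_congr fun n hn ↦ congrArg (c n • ·) (partialSumLinearMap_monomial (hN n hn))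

/-- The jet of the `N`-th partial sum, as a continuous linear map. -/
def partialSumJet (N : ℕ) : Da →L[ℂ] ℕ → C(leftHalfPlane, ℂ) :=
  ∑ n ∈ Finset.range N, (Da.coeffCLM n).smulRight (jet (entireMonomial n))

theorem partialSumJet_apply (N : ℕ) (D : Da) :
    partialSumJet N D = jet (partialSumLinearMap N D) := by
  simp [partialSumJet, partialSumLinearMap]

theorem Da.isUniversal_iff_mem_universalSet (D : Da) :
    D.IsUniversal ↔ D ∈ universalSet (fun N ↦ partialSumJet N) (LinearMap.range jet : Set _) := by
  have tendsto_iff (g : entire) (lam : ℕ → ℕ) :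
      Tendsto (fun j ↦ partialSumJet (lam j) D) atTop (𝓝 (jet g)) ↔
        ∀ (l : ℕ) (K : Set ℂ), IsCompact K → K ⊆ {s : ℂ | s.re ≤ 0} →
          TendstoUniformlyOn (fun j : ℕ ↦ iteratedDeriv l (D.partialSum (lam j)))
            (iteratedDeriv l (g : ℂ → ℂ)) atTop K := by
    simp only [partialSumJet_apply, tendsto_jet_iff, coe_partialSumLinearMap]
  constructor
  · rintro h _ ⟨g, rfl⟩
    obtain ⟨lam, hlam, hg⟩ := h g g.2
    exact .of_comp hlam.tendsto_atTop ((tendsto_iff g lam).2 hg).mapClusterPt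
  · intro h g hg
    obtain ⟨lam, hlam, hjet⟩ := (h (jet ⟨g, hg⟩) ⟨_, rfl⟩).tendsto_subseq
    exact ⟨lam, hlam, (tendsto_iff _ lam).1 hjet⟩

theorem exists_linearCombination_approx {K : Set ℂ} (hK : IsCompact K) {δ : ℝ}
    {σ : {σ : ℝ // 0 < σ}} (hδσ : δ < σ) (hKδ : ∀ s ∈ K, s.re ≤ δ) (g : entire) {ε : ℝ}
    (hε : 0 < ε) :
    ∃ c : ℕ →₀ ℂ, Da.seminorm σ (linearCombination ℂ Da.monomial c) < ε ∧
      ∀ s ∈ K, dist ((g : ℂ → ℂ) s)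
        ((linearCombination ℂ entireMonomial c : ℂ → ℂ) s) < ε := by
  have : CompactSpace K := isCompact_iff_compactSpace.1 hK
  have hmem := zero_prodMk_restrict_mem_topologicalClosure_span σ.2.le hδσ hKδ
    (g := ⟨g, g.2.continuous⟩) g.2
  obtain ⟨_, hy, hdist⟩ := Metric.mem_closure_iff.1 hmem ε hε
  obtain ⟨c, rfl⟩ := (range_linearCombination ℂ).ge hy
  have hfst : (linearCombination ℂ (weightedMonomial σ K) c).1 =
      Da.weighted σ (linearCombination ℂ Da.monomial c) := by
    simp [linearCombination_apply, Finsupp.sum, Prod.fst_sum, Da.weighted_monomial,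
      weightedMonomial]
  have hsnd (s : K) : (linearCombination ℂ (weightedMonomial σ K) c).2 s =
      (linearCombination ℂ entireMonomial c : ℂ → ℂ) s := by
    simp [linearCombination_apply, Finsupp.sum, Prod.snd_sum, entireMonomial,
      weightedMonomial]
  rw [Prod.dist_eq, max_lt_iff, hfst, ContinuousMap.dist_lt_iff hε, dist_zero_left,
    Da.norm_weighted] at hdist
  simp only [hsnd] at hdist
  exact ⟨c, hdist.1, fun s hs ↦ hdist.2 ⟨s, hs⟩⟩

theorem exists_seq_linearCombination_tendsto (σ : {σ : ℝ // 0 < σ}) (g : entire) :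
    ∃ c : ℕ → ℕ →₀ ℂ,
      Tendsto (fun j ↦ Da.seminorm σ (linearCombination ℂ Da.monomial (c j))) atTop
        (𝓝 0) ∧
      Tendsto (fun j ↦ jet (linearCombination ℂ entireMonomial (c j))) atTop
        (𝓝 (jet g)) := by
  have hδ : 0 < (σ / 2 : ℝ) := half_pos σ.2
  have hclosed : IsClosed {s : ℂ | s.re ≤ σ / 2} :=
    isClosed_le Complex.continuous_re continuous_const
  choose c hcσ hcg using fun j : ℕ ↦ exists_linearCombination_approx
    ((isCompact_closedBall (0 : ℂ) j).inter_right hclosed) (half_lt_self σ.2) (fun s hs ↦ hs.2) g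
    (Nat.one_div_pos_of_nat (α := ℝ) (n := j))
  refine ⟨c, squeeze_zero (fun j ↦ apply_nonneg _ _) (fun j ↦ (hcσ j).le)
    tendsto_one_div_add_atTop_nhds_zero_nat, tendsto_jet_of_tendstoLocallyUniformlyOn hδ <|
    (tendstoLocallyUniformlyOn_iff_forall_isCompact
      (isOpen_lt Complex.continuous_re continuous_const)).2 fun K hKδ hK ↦ ?_⟩
  obtain ⟨r, hr⟩ := hK.isBounded.subset_closedBall (0 : ℂ)
  refine Metric.tendstoUniformlyOn_iff.2 fun ε hε ↦ ?_
  filter_upwards [eventually_ge_atTop ⌈r⌉₊,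
    tendsto_one_div_add_atTop_nhds_zero_nat.eventually_lt_const hε] with j hrj hjε s hs
  exact (hcg j s ⟨Metric.closedBall_subset_closedBall (Nat.ceil_le.1 hrj) (hr hs),
    (show s.re < σ / 2 from hKδ hs).le⟩).trans hjε

theorem hasDenseBasins_partialSumJet :
    HasDenseBasins (fun N ↦ partialSumJet N) (LinearMap.range jet : Set _) := by
  rintro _ ⟨g, rfl⟩ B hB
  refine .of_closure (Da.dense_span_monomial.mono fun P hP ↦ mem_closure_iff_nhds.2 fun U hU ↦ ?_)
  obtain ⟨a, rfl⟩ := (range_linearCombination ℂ).ge hP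
  obtain ⟨k, r, hr, hball⟩ := Da.exists_ball_exponent_subset hU
  obtain ⟨c, hc, hjet⟩ := exists_seq_linearCombination_tendsto (Da.exponent k)
    (g - linearCombination ℂ entireMonomial a)
  have hjet_add := hjet.const_add (jet (linearCombination ℂ entireMonomial a))
  rw [← map_add, add_sub_cancel] at hjet_add
  obtain ⟨j, hjr, hjB⟩ := ((hc.eventually_lt_const hr).and (hjet_add.eventually_mem hB)).exists
  refine ⟨linearCombination ℂ Da.monomial (a + c j), hball ?_, ?_⟩
  · rwa [Seminorm.mem_ball, map_add, add_sub_cancel_left]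
  · filter_upwards [eventually_partialSumLinearMap_linearCombination (a + c j)] with N hN
    rwa [partialSumJet_apply, hN, map_add, map_add]

end Conclusion

end DirichletSeries

end

theorem mainTheorem6 :
    (∃ D : DirichletSeries.Da, D.IsUniversal) ∧
    Dense {D : DirichletSeries.Da | D.IsUniversal} ∧
    IsGδ {D : DirichletSeries.Da | D.IsUniversal} ∧
    ∃ V : Submodule ℂ DirichletSeries.Da,
      Dense (V : Set DirichletSeries.Da) ∧
      ∀ D ∈ V, D ≠ 0 → D.IsUniversal := by
  have hdense := DirichletSeries.hasDenseBasins_partialSumJet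
  have hcont (N : ℕ) := (DirichletSeries.partialSumJet N).continuous
  have huniv : {D : DirichletSeries.Da | D.IsUniversal} = _ :=
    Set.ext DirichletSeries.Da.isUniversal_iff_mem_universalSet
  have huniv_dense : Dense {D : DirichletSeries.Da | D.IsUniversal} :=
    huniv ▸ dense_of_mem_residual (hdense.universalSet_mem_residual hcont)
  refine ⟨huniv_dense.nonempty, huniv_dense,
    huniv ▸ DirichletSeries.isGδ_universalSet hcont _, ?_⟩
  obtain ⟨V, hV, hV_universal⟩ := hdense.exists_dense_submodule
  exact ⟨V, hV, fun D hD hD0 ↦ D.isUniversal_iff_mem_universalSet.2 (hV_universal D hD hD0)⟩
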